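/- Let $d\ge 1$, let $V\subset\mathbb{R}^d$ be non-empty, open and bounded, and let $f:\partial V\to\mathbb{R}$ be continuous. Let $\vartheta_1,\vartheta_2,\dots$ be independent random variables on a probability space $(\Omega,\mathcal F,P)$, each uniformly distributed on the unit sphere of $\mathbb{R}^d$ (for $d=1$: on $\{-1,1\}$). For $v\in V$ and $0<r<1$ define the walk $$X_r^v(1)=v,\qquad X_r^v(n+1)=X_r^v(n)+r\,d\bigl(X_r^v(n),\partial V\bigr)\,\vartheta_n\quad(n\ge 1),$$ where $d(x,\partial V)$ is the Euclidean distance from $x$ to $\partial V$. Put $X_r^v(\infty)=\lim_{n\to\infty}X_r^v(n)$ where this limit exists, and define $h_r:\overline V\to\mathbb{R}$ by $h_r(v)=f(v)$ for $v\in\partial V$ and $h_r(v)=E[f(X_r^v(\infty))]$ for $v\in V$. Then $h_r$ is well defined and does not depend on $r$. Precisely: 1. for all $r\in(0,1)$ and $v\in V$, almost surely the limit $X_r^v(\infty)$ exists and lies in $\partial V$, and $f(X_r^v(\infty))$ is integrable; 2. $h_r=h_s$ on $\overline V$ for all $r,s\in(0,1)$; that is, $E[f(X_r^v(\infty))]=E[f(X_s^v(\infty))]$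 for every $v\in V$; 3. for every $v\in V$ and all $r,s\in(0,1)$, the random points $X_r^v(\infty)$ and $X_s^v(\infty)$ have the same distribution. -/

import Mathlib

open MeasureTheory ProbabilityTheory Filter Topology Set

namespace WalkOnSpheres

noncomputable section

/-- The uniform distribution on the unit sphere of `ℝ^d`, as a measure on `ℝ^d`: the surface
measure on the sphere induced by Lebesgue measure, normalized to total mass one. -/
def uniformSphere (d : ℕ) : Measure (EuclideanSpace ℝ (Fin d)) :=
  Measure.map (Subtype.val : Metric.sphere (0 : EuclideanSpace ℝ (Fin d)) 1 → _)
    (((volume : Measure (EuclideanSpace ℝ (Fin d))).toSphere univ)⁻¹ •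
      (volume : Measure (EuclideanSpace ℝ (Fin d))).toSphere)

variable {d : ℕ} {Ω : Type*}

/-- The walk in `V` with ratio `r`, started at `v` and driven by `ϑ`; time is indexed from `0`:
`X 0 = v` and `X (n + 1) = X n + r d(X n, ∂V) ϑ n`. -/
def walk (V : Set (EuclideanSpace ℝ (Fin d))) (ϑ : ℕ → Ω → EuclideanSpace ℝ (Fin d))
    (r : ℝ) (v : EuclideanSpace ℝ (Fin d)) : ℕ → Ω → EuclideanSpace ℝ (Fin d)
  | 0, _ => v
  | n + 1, ω => walk V ϑ r v n ω +
      (r * Metric.infDist (walk V ϑ r v n ω) (frontier V)) • ϑ n ω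

/-- The limit `X(∞)` of the walk (an arbitrary value where the walk does not converge). -/
def walkLimit (V : Set (EuclideanSpace ℝ (Fin d))) (ϑ : ℕ → Ω → EuclideanSpace ℝ (Fin d))
    (r : ℝ) (v : EuclideanSpace ℝ (Fin d)) (ω : Ω) : EuclideanSpace ℝ (Fin d) :=
  limUnder atTop (fun n => walk V ϑ r v n ω)

open Classical in
/-- The function `h` on the closure of `V`, computed with ratio `r`: it is `f` on the boundary and
`E[f(X(∞))]` inside `V`. Only the values of `f` on the boundary matter. -/
def dirichletFun [MeasurableSpace Ω] (P : Measure Ω) (V : Set (EuclideanSpace ℝ (Fin d)))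
    (ϑ : ℕ → Ω → EuclideanSpace ℝ (Fin d)) (f : EuclideanSpace ℝ (Fin d) → ℝ) (r : ℝ)
    (v : closure V) : ℝ :=
  if (v : EuclideanSpace ℝ (Fin d)) ∈ frontier V then f v
  else ∫ ω, f (walkLimit V ϑ r v ω) ∂P

end

end WalkOnSpheres

/-!
The laws of the limits are compared through the functions `exp ⟪a, ·⟫`, which lie below their
spherical means, so that their expectations increase along every walk. They determine a law with
bounded support: their integrals give the moment generating functions of the linear forms, hence
by analytic continuation the characteristic function. It therefore suffices to bound
`E[G(X_r(∞))]` by `E[G(X_s(∞))]` for `G = exp ⟪a, ·⟫` and arbitrary ratios `r`, `s`.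

The walks with ratios `r` and `s` cannot be compared with each other step by step; both are compared
with the walk whose steps have a tiny constant length `ε`. Let `u` be the value function of that
walk when it is stopped within distance `δ` of the boundary and is then paid `G`. It satisfies the
mean value equality with step `ε` where it is not stopped, and `u` is at most its mean wherever the
distance to the boundary exceeds `ε`.
A walk with constant step started at the centre of a ball leaves the ball with a rotation invariant
law, overshooting by less than `ε`; consequently `u` at the centre is, up to `O(ε)`, comparable with
the mean over the sphere of any Lipschitz function comparable with `u` near the sphere. In
`sphereMean_sub_le_of_sphereMean_le` this is proved without any stopped process: the spherical means
of `u` about the centre depend on the radius only and satisfy a mean inequality themselves, and for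
functions of one variable the minimum principle is an argument on infima. That lemma rests on
`integral_uniformSphere_add_eq`, by which a sum of independent uniform vectors on two spheres is
distributed as a radius times an independent uniform direction, a consequence of the uniqueness
theorem for characteristic functions.

Iterating the comparison along the two walks (`exists_iterate_walkMean_sub_le`) and letting
`ε → 0` gives `E[G(X_r(n))] ≤ E[G(X_s(m)) + (C / δ) d(X_s(m), ∂V)]`, where `δ` depends on `n` but
not on `m` (`iterate_walkMean_le_iterate_walkMean`). The walks are bounded martingales, so they
converge almost surely, and their step lengths tend to zero, so the limits are on the boundary. With
`m → ∞` the correction disappears, and `n → ∞` gives the claim.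
-/

namespace WalkOnSpheres

/-! ### The uniform distribution on the sphere -/

section Sphere

open scoped Pointwise RealInnerProductSpace

variable {d : ℕ}

instance isProbabilityMeasure_uniformSphere [NeZero d] :
    IsProbabilityMeasure (uniformSphere d) := by
  have hdim : Nontrivial (EuclideanSpace ℝ (Fin d)) := by
    refine Module.nontrivial_of_finrank_pos (R := ℝ) ?_
    rw [finrank_euclideanSpace_fin]
    exact Nat.pos_of_ne_zero (NeZero.ne d)
  have h0 : (volume : Measure (EuclideanSpace ℝ (Fin d))).toSphere univ ≠ 0 := by
    rw [Ne, Measure.measure_univ_eq_zero]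
    exact Measure.toSphere_ne_zero _
  unfold uniformSphere
  have : IsProbabilityMeasure
      (((volume : Measure (EuclideanSpace ℝ (Fin d))).toSphere univ)⁻¹ •
        (volume : Measure (EuclideanSpace ℝ (Fin d))).toSphere) := by
    refine ⟨?_⟩
    rw [Measure.smul_apply, smul_eq_mul]
    exact ENNReal.inv_mul_cancel h0 (measure_ne_top _ _)
  exact Measure.isProbabilityMeasure_map measurable_subtype_coe.aemeasurable

lemma ae_norm_eq_one_uniformSphere (d : ℕ) : ∀ᵐ θ ∂uniformSphere d, ‖θ‖ = 1 := by
  unfold uniformSphere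
  rw [ae_map_iff measurable_subtype_coe.aemeasurable
    (measurableSet_eq_fun measurable_norm measurable_const)]
  exact ae_of_all _ fun x => by simp

lemma toSphere_val_preimage (s : Set (EuclideanSpace ℝ (Fin d))) (hs : MeasurableSet s) :
    (volume : Measure (EuclideanSpace ℝ (Fin d))).toSphere (Subtype.val ⁻¹' s) =
      Module.finrank ℝ (EuclideanSpace ℝ (Fin d)) *
        volume (Ioo (0 : ℝ) 1 • (s ∩ Metric.sphere (0 : EuclideanSpace ℝ (Fin d)) 1)) := by
  rw [Measure.toSphere_apply' _ (measurable_subtype_coe hs), Subtype.image_preimage_coe,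
    inter_comm]

/-- The uniform distribution on the sphere inherits the isometry invariance of Lebesgue measure. -/
lemma map_uniformSphere (Q : EuclideanSpace ℝ (Fin d) ≃ₗᵢ[ℝ] EuclideanSpace ℝ (Fin d)) :
    (uniformSphere d).map Q = uniformSphere d := by
  have hQ : Measurable Q := Q.continuous.measurable
  ext s hs
  rw [Measure.map_apply hQ hs]
  unfold uniformSphere
  rw [Measure.map_apply measurable_subtype_coe hs,
    Measure.map_apply measurable_subtype_coe (hQ hs), Measure.smul_apply, Measure.smul_apply,
    toSphere_val_preimage _ hs, toSphere_val_preimage _ (hQ hs)]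
  congr 2
  have key : Ioo (0 : ℝ) 1 • (Q ⁻¹' s ∩ Metric.sphere (0 : EuclideanSpace ℝ (Fin d)) 1) =
      Q ⁻¹' (Ioo (0 : ℝ) 1 • (s ∩ Metric.sphere (0 : EuclideanSpace ℝ (Fin d)) 1)) := by
    ext x
    simp only [Set.mem_smul, mem_preimage, mem_inter_iff, mem_sphere_iff_norm, sub_zero]
    constructor
    · rintro ⟨t, ht, y, ⟨hy, hy1⟩, rfl⟩
      exact ⟨t, ht, Q y, ⟨hy, by simpa using hy1⟩, by simp⟩
    · rintro ⟨t, ht, y, ⟨hy, hy1⟩, hxy⟩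
      refine ⟨t, ht, Q.symm y, ⟨by simpa using hy, by simpa using hy1⟩, ?_⟩
      change t • y = Q x at hxy
      rw [← map_smul, hxy, Q.symm_apply_apply]
  rw [key]
  exact Q.measurePreserving.measure_preimage_emb Q.toHomeomorph.measurableEmbedding _

lemma integrable_of_forall_abs_le {α : Type*} [MeasurableSpace α] {μ : Measure α}
    [IsFiniteMeasure μ] {u : α → ℝ} (hu : Measurable u) {C : ℝ} (hC : ∀ x, |u x| ≤ C) :
    Integrable u μ :=
  Integrable.of_bound hu.aestronglyMeasurable C (ae_of_all _ hC)

lemma abs_integral_le_of_forall_abs_le {α : Type*} [MeasurableSpace α] {μ : Measure α}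
    [IsProbabilityMeasure μ] {u : α → ℝ} {C : ℝ} (hC : ∀ x, |u x| ≤ C) :
    |∫ x, u x ∂μ| ≤ C := by
  simpa using norm_integral_le_of_norm_le_const (μ := μ) (f := u) (ae_of_all _ hC)

lemma integrable_inner_uniformSphere [NeZero d] (a : EuclideanSpace ℝ (Fin d)) :
    Integrable (fun θ => ⟪a, θ⟫) (uniformSphere d) := by
  refine Integrable.of_bound (by fun_prop) ‖a‖ ?_
  filter_upwards [ae_norm_eq_one_uniformSphere d] with θ hθ
  simpa [hθ] using norm_inner_le_norm (𝕜 := ℝ) a θ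

lemma integral_inner_uniformSphere (a : EuclideanSpace ℝ (Fin d)) :
    ∫ θ, ⟪a, θ⟫ ∂uniformSphere d = 0 := by
  have h : ∫ θ, ⟪a, θ⟫ ∂uniformSphere d = ∫ θ, ⟪a, -θ⟫ ∂uniformSphere d := by
    conv_lhs => rw [← map_uniformSphere (LinearIsometryEquiv.neg ℝ)]
    rw [integral_map (LinearIsometryEquiv.neg ℝ).continuous.measurable.aemeasurable
      (by fun_prop)]
    simp
  simp only [inner_neg_right, integral_neg] at h
  linarith

lemma charFun_uniformSphere_of_norm_eq {ξ η : EuclideanSpace ℝ (Fin d)} (h : ‖ξ‖ = ‖η‖) :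
    charFun (uniformSphere d) ξ = charFun (uniformSphere d) η := by
  -- the reflection exchanging `ξ` and `η`
  set Q := (ℝ ∙ (ξ - η))ᗮ.reflection
  have hQ : Q ξ = η := Submodule.reflection_sub h
  rw [charFun_apply, charFun_apply]
  conv_rhs => rw [← map_uniformSphere Q]
  rw [integral_map Q.continuous.measurable.aemeasurable (by fun_prop)]
  refine integral_congr_ae (ae_of_all _ fun θ => ?_)
  simp only
  rw [← hQ, Q.inner_map_map]

/-- A finite measure with radial characteristic function is the law of `‖Y‖ • η`, where `η` is
uniform on the sphere and independent of `Y`, whose law is the given measure. Exchanging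
the roles of the point and the frequency turns one characteristic function into the other. -/
lemma eq_map_norm_smul_of_charFun_radial [NeZero d] (Λ : Measure (EuclideanSpace ℝ (Fin d)))
    [IsFiniteMeasure Λ] (hΛ : ∀ ξ η, ‖ξ‖ = ‖η‖ → charFun Λ ξ = charFun Λ η) :
    Λ = (Λ.prod (uniformSphere d)).map (fun p => ‖p.1‖ • p.2) := by
  refine Measure.ext_of_charFun (funext fun ξ => ?_)
  rw [charFun_apply (μ := Measure.map _ _), integral_map (by fun_prop) (by fun_prop)]
  have hint : ∀ c : EuclideanSpace ℝ (Fin d) × EuclideanSpace ℝ (Fin d) → ℝ, Measurable c →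
      Integrable (fun p => Complex.exp (c p * Complex.I)) (Λ.prod (uniformSphere d)) := by
    intro c hc
    refine Integrable.of_bound (by fun_prop) 1 (ae_of_all _ fun p => ?_)
    rw [Complex.norm_exp_ofReal_mul_I]
  rw [integral_prod _ (hint _ (by fun_prop))]
  have h1 : ∀ y : EuclideanSpace ℝ (Fin d),
      ∫ θ, Complex.exp ((⟪‖y‖ • θ, ξ⟫ : ℝ) * Complex.I) ∂uniformSphere d =
        ∫ θ, Complex.exp ((⟪y, ‖ξ‖ • θ⟫ : ℝ) * Complex.I) ∂uniformSphere d := by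
    intro y
    have := charFun_uniformSphere_of_norm_eq (ξ := ‖y‖ • ξ) (η := ‖ξ‖ • y)
      (by rw [norm_smul, norm_smul, norm_norm, norm_norm, mul_comm])
    rw [charFun_apply, charFun_apply] at this
    simp only [real_inner_smul_left, real_inner_smul_right] at this ⊢
    rw [this]
    simp only [real_inner_comm]
  simp only [h1]
  rw [integral_integral_swap (hint (fun p => ⟪p.1, ‖ξ‖ • p.2⟫) (by fun_prop))]
  have h2 : ∀ᵐ θ ∂uniformSphere d,
      ∫ y, Complex.exp ((⟪y, ‖ξ‖ • θ⟫ : ℝ) * Complex.I) ∂Λ = charFun Λ ξ := by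
    filter_upwards [ae_norm_eq_one_uniformSphere d] with θ hθ
    rw [← charFun_apply]
    exact hΛ _ _ (by rw [norm_smul, hθ, norm_norm, mul_one])
  rw [integral_congr_ae h2]
  simp

/-- The sum of two independent vectors, uniform on spheres about the origin, has a rotation
invariant law: integrating a function against it is the same as integrating its spherical means. -/
lemma integral_uniformSphere_add_eq [NeZero d] {u : EuclideanSpace ℝ (Fin d) → ℝ}
    (hu : Measurable u) {C : ℝ} (hC : ∀ x, |u x| ≤ C) (t ε : ℝ) :
    ∫ θ, ∫ ζ, u (t • θ + ε • ζ) ∂uniformSphere d ∂uniformSphere d =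
      ∫ θ, ∫ ζ, ∫ η, u (‖t • θ + ε • ζ‖ • η) ∂uniformSphere d ∂uniformSphere d
        ∂uniformSphere d := by
  set σ := uniformSphere d
  set Λ : Measure (EuclideanSpace ℝ (Fin d)) := (σ.map (t • ·)) ∗ (σ.map (ε • ·)) with hΛdef
  have : IsProbabilityMeasure (σ.map (t • ·)) :=
    Measure.isProbabilityMeasure_map (by fun_prop)
  have : IsProbabilityMeasure (σ.map (ε • ·)) :=
    Measure.isProbabilityMeasure_map (by fun_prop)
  have hrad : ∀ ξ η, ‖ξ‖ = ‖η‖ → charFun Λ ξ = charFun Λ η := by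
    intro ξ η h
    rw [hΛdef, charFun_conv, charFun_conv]
    simp only [charFun_map_smul]
    rw [charFun_uniformSphere_of_norm_eq (ξ := t • ξ) (η := t • η) (by simp [norm_smul, h]),
      charFun_uniformSphere_of_norm_eq (ξ := ε • ξ) (η := ε • η) (by simp [norm_smul, h])]
  have hconv : ∀ φ : EuclideanSpace ℝ (Fin d) → ℝ, Measurable φ → (∀ x, |φ x| ≤ C) →
      ∫ x, φ x ∂Λ = ∫ θ, ∫ ζ, φ (t • θ + ε • ζ) ∂σ ∂σ := by
    intro φ hφ hφC
    rw [hΛdef, integral_conv (integrable_of_forall_abs_le hφ hφC),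
      integral_map (by fun_prop)]
    · refine integral_congr_ae (ae_of_all _ fun θ => ?_)
      simp only
      rw [integral_map (by fun_prop) (Measurable.aestronglyMeasurable (by fun_prop))]
    · exact (StronglyMeasurable.integral_prod_right'
        (f := fun p : EuclideanSpace ℝ (Fin d) × EuclideanSpace ℝ (Fin d) => φ (p.1 + p.2))
        (Measurable.stronglyMeasurable (by fun_prop))).aestronglyMeasurable
  have hmean : Measurable fun y : EuclideanSpace ℝ (Fin d) => ∫ η, u (‖y‖ • η) ∂σ :=
    (Measurable.stronglyMeasurable (f := fun p : EuclideanSpace ℝ (Fin d) ×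
      EuclideanSpace ℝ (Fin d) => u (‖p.1‖ • p.2)) (by fun_prop)).integral_prod_right'.measurable
  rw [← hconv u hu hC, ← hconv _ hmean fun y => ?_]
  · conv_lhs => rw [eq_map_norm_smul_of_charFun_radial Λ hrad]
    rw [integral_map (by fun_prop) hu.aestronglyMeasurable, integral_prod]
    exact integrable_of_forall_abs_le (by fun_prop) fun p => hC _
  · exact abs_integral_le_of_forall_abs_le fun η => hC _

lemma integral_norm_add_smul_sq [NeZero d] (y : EuclideanSpace ℝ (Fin d)) (ε : ℝ) :
    ∫ ζ, ‖y + ε • ζ‖ ^ 2 ∂uniformSphere d = ‖y‖ ^ 2 + ε ^ 2 := by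
  have h : ∀ᵐ ζ ∂uniformSphere d, ‖y + ε • ζ‖ ^ 2 = (‖y‖ ^ 2 + ε ^ 2) + 2 * ε * ⟪y, ζ⟫ := by
    filter_upwards [ae_norm_eq_one_uniformSphere d] with ζ hζ
    rw [norm_add_sq_real, norm_smul, hζ, real_inner_smul_right, mul_one, Real.norm_eq_abs, sq_abs]
    ring
  rw [integral_congr_ae h, integral_add (integrable_const _)
    ((integrable_inner_uniformSphere y).const_mul _), integral_const_mul,
    integral_inner_uniformSphere]
  simp

end Sphere

/-! ### Spherical means and the comparison principle in a ball -/

section SphereMean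

open scoped RealInnerProductSpace NNReal

variable {d : ℕ}

/-- The mean of `φ` over the sphere of radius `ρ` about `x`. -/
noncomputable def sphereMean (ρ : ℝ) (φ : EuclideanSpace ℝ (Fin d) → ℝ)
    (x : EuclideanSpace ℝ (Fin d)) : ℝ :=
  ∫ θ, φ (x + ρ • θ) ∂uniformSphere d

lemma integrable_uniformSphere_of_continuous [NeZero d] {φ : EuclideanSpace ℝ (Fin d) → ℝ}
    (hφ : Continuous φ) : Integrable φ (uniformSphere d) := by
  obtain ⟨C, hC⟩ := (isCompact_sphere (0 : EuclideanSpace ℝ (Fin d)) 1).exists_bound_of_continuousOn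
    hφ.continuousOn
  refine Integrable.of_bound hφ.aestronglyMeasurable C ?_
  filter_upwards [ae_norm_eq_one_uniformSphere d] with θ hθ
  exact hC θ (by simpa using hθ)

lemma measurable_sphereMean [NeZero d] {α : Type*} [MeasurableSpace α]
    {φ : EuclideanSpace ℝ (Fin d) → ℝ} (hφ : Measurable φ) {ρ : α → ℝ} (hρ : Measurable ρ)
    {y : α → EuclideanSpace ℝ (Fin d)} (hy : Measurable y) :
    Measurable fun a => sphereMean (ρ a) φ (y a) :=
  (Measurable.stronglyMeasurable (f := fun p : α × EuclideanSpace ℝ (Fin d) =>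
    φ (y p.1 + ρ p.1 • p.2)) (by fun_prop)).integral_prod_right'.measurable

lemma abs_sphereMean_le [NeZero d] {φ : EuclideanSpace ℝ (Fin d) → ℝ} {C : ℝ}
    (hC : ∀ x, |φ x| ≤ C) (ρ : ℝ) (x : EuclideanSpace ℝ (Fin d)) : |sphereMean ρ φ x| ≤ C :=
  abs_integral_le_of_forall_abs_le fun _ => hC _

@[simp]
lemma sphereMean_zero [NeZero d] (φ : EuclideanSpace ℝ (Fin d) → ℝ)
    (x : EuclideanSpace ℝ (Fin d)) : sphereMean 0 φ x = φ x := by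
  simp [sphereMean]

lemma sphereMean_mono [NeZero d] {φ ψ : EuclideanSpace ℝ (Fin d) → ℝ} {ρ : ℝ} (hρ : 0 ≤ ρ)
    {x : EuclideanSpace ℝ (Fin d)}
    (hφ : Integrable (fun θ => φ (x + ρ • θ)) (uniformSphere d))
    (hψ : Integrable (fun θ => ψ (x + ρ • θ)) (uniformSphere d))
    (h : ∀ y, ‖y - x‖ = ρ → φ y ≤ ψ y) : sphereMean ρ φ x ≤ sphereMean ρ ψ x := by
  refine integral_mono_ae hφ hψ ?_
  filter_upwards [ae_norm_eq_one_uniformSphere d] with θ hθ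
  exact h _ (by simp [norm_smul, hθ, abs_of_nonneg hρ])

/-- Averaging the mean inequality `sphereMean ε u y ≤ u y` over the directions of `y - x`: the
spherical means of `u` about `x` again satisfy a mean inequality, with the same step `ε`. -/
lemma integral_sphereMean_norm_le [NeZero d] {u : EuclideanSpace ℝ (Fin d) → ℝ}
    (hu : Measurable u) {C : ℝ} (hC : ∀ x, |u x| ≤ C) {x : EuclideanSpace ℝ (Fin d)}
    {t ε : ℝ} (ht : 0 ≤ t) (h : ∀ y, ‖y - x‖ = t → sphereMean ε u y ≤ u y) :
    ∫ θ, ∫ ζ, sphereMean ‖t • θ + ε • ζ‖ u x ∂uniformSphere d ∂uniformSphere d ≤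
      sphereMean t u x := by
  have hrad := integral_uniformSphere_add_eq (u := fun y => u (x + y)) (by fun_prop)
    (fun y => hC _) t ε
  refine hrad.ge.trans ?_
  simp only [← add_assoc]
  have hmean := measurable_sphereMean hu (measurable_const (a := ε))
    (y := fun y : EuclideanSpace ℝ (Fin d) => y) measurable_id
  refine sphereMean_mono (φ := fun y => sphereMean ε u y) ht
    (integrable_of_forall_abs_le (hmean.comp (by fun_prop)) fun θ => abs_sphereMean_le hC _ _)
    (integrable_of_forall_abs_le (by fun_prop) fun θ => hC _) h

/-- **Comparison in a ball.** Let `u` satisfy the mean inequality with step `ε` in the ball of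
radius `R` about `x`, and dominate a Lipschitz function `φ` in the shell of width `ε` around that
ball, which a step from the ball cannot overshoot. Then `u x` dominates the mean of `φ` over the
sphere of radius `R`, up to the oscillation of `φ` across the shell. No regularity of `u` beyond
measurability is required: the spherical means of `u` about `x` depend on the radius only, and for
them the minimum principle is an argument on infima. -/
lemma sphereMean_sub_le_of_sphereMean_le [NeZero d] {u φ : EuclideanSpace ℝ (Fin d) → ℝ}
    (hu : Measurable u) {C : ℝ} (hC : ∀ x, |u x| ≤ C) {K : ℝ≥0} (hφ : LipschitzWith K φ)
    {x : EuclideanSpace ℝ (Fin d)} {R ε : ℝ} (hR : 0 < R) (hε : 0 < ε)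
    (hmean : ∀ y, ‖y - x‖ < R → sphereMean ε u y ≤ u y)
    (hshell : ∀ y, R ≤ ‖y - x‖ → ‖y - x‖ < R + ε → φ y ≤ u y) :
    sphereMean R φ x - K * ε ≤ u x := by
  set c := sphereMean R φ x - K * ε with hc
  set W : ℝ → ℝ := fun t => sphereMean t u x with hW
  have hWm : Measurable W := measurable_sphereMean hu measurable_id measurable_const
  have hWC : ∀ t, |W t| ≤ C := fun t => abs_sphereMean_le hC t x
  have hφi : ∀ t : ℝ, Integrable (fun θ => φ (x + t • θ)) (uniformSphere d) := fun t =>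
    integrable_uniformSphere_of_continuous (hφ.continuous.comp (by fun_prop))
  have hout : ∀ t, R ≤ t → t < R + ε → c ≤ W t := by
    intro t htR ht
    have h1 : c = ∫ θ, (φ (x + R • θ) - K * ε) ∂uniformSphere d := by
      rw [integral_sub (hφi R) (integrable_const _)]
      simp [hc, sphereMean]
    rw [h1]
    refine integral_mono_ae ((hφi R).sub (integrable_const _))
      (integrable_of_forall_abs_le (by fun_prop) fun θ => hC _) ?_
    filter_upwards [ae_norm_eq_one_uniformSphere d] with θ hθ
    have hn : ‖x + t • θ - x‖ = t := by
      simp [norm_smul, hθ, abs_of_nonneg (hR.le.trans htR)]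
    have h2 : φ (x + R • θ) - φ (x + t • θ) ≤ K * ε := by
      refine (le_abs_self _).trans ((hφ.dist_le_mul _ _).trans ?_)
      refine mul_le_mul_of_nonneg_left ?_ K.2
      rw [dist_add_left, dist_eq_norm, ← sub_smul, norm_smul, hθ, mul_one, Real.norm_eq_abs,
        abs_le]
      constructor <;> linarith
    have h3 := hshell (x + t • θ) (by rw [hn]; exact htR) (by rw [hn]; exact ht)
    linarith
  have hin : ∀ κ > 0, c - κ * (R + ε) ^ 2 ≤ u x := by
    intro κ hκ
    set Z : ℝ → ℝ := fun t => W t - κ * t ^ 2 with hZ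
    set m := sInf (Z '' Ico 0 R) with hm
    have hZ0 : Z 0 = u x := by simp [hZ, hW]
    have hbdd : BddBelow (Z '' Ico 0 R) := by
      refine ⟨-C - κ * R ^ 2, ?_⟩
      rintro _ ⟨t, ht, rfl⟩
      have h1 := (abs_le.1 (hWC t)).1
      have h2 : κ * t ^ 2 ≤ κ * R ^ 2 := by
        have := ht.1; have := ht.2.le
        gcongr
      simp only [hZ]
      linarith
    have hm0 : m ≤ u x := hZ0 ▸ csInf_le hbdd ⟨0, ⟨le_rfl, hR⟩, rfl⟩
    refine le_trans ?_ hm0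
    by_contra! hlt
    have hlow : ∀ t, 0 ≤ t → t < R + ε → m + κ * t ^ 2 ≤ W t := by
      intro t ht0 ht
      rcases lt_or_ge t R with htR | htR
      · have := csInf_le hbdd ⟨t, ⟨ht0, htR⟩, rfl⟩
        simp only [hZ] at this
        linarith
      · have h1 := hout t htR ht
        have h2 : κ * t ^ 2 ≤ κ * (R + ε) ^ 2 := by gcongr
        linarith
    -- each value of `Z` on `[0, R)` exceeds the infimum by the second moment of the step
    have hstep : ∀ t ∈ Ico 0 R, m + κ * ε ^ 2 ≤ Z t := by
      rintro t ⟨ht0, htR⟩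
      have h1 := integral_sphereMean_norm_le (x := x) hu hC (ε := ε) ht0
        (fun y hy => hmean y (hy ▸ htR))
      have h2 : m + κ * (t ^ 2 + ε ^ 2) ≤
          ∫ θ, ∫ ζ, W ‖t • θ + ε • ζ‖ ∂uniformSphere d ∂uniformSphere d := by
        have hconst : m + κ * (t ^ 2 + ε ^ 2) =
            ∫ _ : EuclideanSpace ℝ (Fin d), (m + κ * (t ^ 2 + ε ^ 2)) ∂uniformSphere d := by simp
        rw [hconst]
        have hmeas : Measurable fun θ : EuclideanSpace ℝ (Fin d) =>
            ∫ ζ, W ‖t • θ + ε • ζ‖ ∂uniformSphere d :=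
          (Measurable.stronglyMeasurable (f := fun p : EuclideanSpace ℝ (Fin d) ×
            EuclideanSpace ℝ (Fin d) => W ‖t • p.1 + ε • p.2‖)
            (by fun_prop)).integral_prod_right'.measurable
        refine integral_mono_ae (integrable_const _) (integrable_of_forall_abs_le hmeas
          fun θ => abs_integral_le_of_forall_abs_le fun ζ => hWC _) ?_
        filter_upwards [ae_norm_eq_one_uniformSphere d] with θ hθ
        have hsq : Integrable (fun ζ => κ * ‖t • θ + ε • ζ‖ ^ 2) (uniformSphere d) :=
          integrable_uniformSphere_of_continuous (by fun_prop)
        have h3 : m + κ * (t ^ 2 + ε ^ 2) =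
            ∫ ζ, (m + κ * ‖t • θ + ε • ζ‖ ^ 2) ∂uniformSphere d := by
          rw [integral_add (integrable_const _) hsq, integral_const_mul,
            integral_norm_add_smul_sq, norm_smul, hθ, mul_one, Real.norm_eq_abs, sq_abs]
          simp
        rw [h3]
        refine integral_mono_ae ((integrable_const _).add hsq)
          (integrable_of_forall_abs_le (by fun_prop) fun ζ => hWC _) ?_
        filter_upwards [ae_norm_eq_one_uniformSphere d] with ζ hζ
        refine hlow _ (norm_nonneg _) ?_
        calc ‖t • θ + ε • ζ‖ ≤ ‖t • θ‖ + ‖ε • ζ‖ := norm_add_le _ _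
          _ = t + ε := by
            rw [norm_smul, norm_smul, hθ, hζ, mul_one, mul_one, Real.norm_of_nonneg ht0,
              Real.norm_of_nonneg hε.le]
          _ < R + ε := by linarith
      have h4 := h2.trans h1
      simp only [hZ, hW]
      linarith
    have h5 : m + κ * ε ^ 2 ≤ m := by
      refine le_csInf ⟨Z 0, 0, ⟨le_rfl, hR⟩, rfl⟩ ?_
      rintro _ ⟨t, ht, rfl⟩
      exact hstep t ht
    have : 0 < κ * ε ^ 2 := by positivity
    linarith
  refine le_of_forall_pos_le_add fun η hη => ?_
  have hpos : 0 < (R + ε) ^ 2 := by positivity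
  have := hin (η / (R + ε) ^ 2) (by positivity)
  rw [div_mul_cancel₀ _ hpos.ne'] at this
  linarith

end SphereMean

/-! ### Iterated means along the walk -/

section WalkMean

open scoped RealInnerProductSpace NNReal

variable {d : ℕ} {V : Set (EuclideanSpace ℝ (Fin d))}

/-- The transition operator of the walk with ratio `r`: the mean of `φ` over the sphere about `x`
whose radius is `r` times the distance from `x` to the boundary of `V`. -/
noncomputable def walkMean (V : Set (EuclideanSpace ℝ (Fin d))) (r : ℝ)
    (φ : EuclideanSpace ℝ (Fin d) → ℝ) (x : EuclideanSpace ℝ (Fin d)) : ℝ :=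
  sphereMean (r * Metric.infDist x (frontier V)) φ x

lemma mem_of_norm_sub_lt_infDist_frontier (hV : IsOpen V) {x y : EuclideanSpace ℝ (Fin d)}
    (hx : x ∈ V) (hy : ‖y - x‖ < Metric.infDist x (frontier V)) : y ∈ V := by
  have hsub : Metric.ball x (Metric.infDist x (frontier V)) ⊆ V ∪ (closure V)ᶜ := by
    intro z hz
    by_contra hzV
    simp only [mem_union, mem_compl_iff, not_or, not_not] at hzV
    have hzf : z ∈ frontier V := by
      rw [hV.frontier_eq]
      exact ⟨hzV.2, hzV.1⟩
    have := Metric.infDist_le_dist_of_mem (x := x) hzf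
    rw [Metric.mem_ball, dist_comm] at hz
    linarith
  have hpos : 0 < Metric.infDist x (frontier V) := (norm_nonneg _).trans_lt hy
  refine (convex_ball x _).isPreconnected.subset_left_of_subset_union hV
    isClosed_closure.isOpen_compl
    (disjoint_compl_right.mono_left subset_closure) hsub
    ⟨x, Metric.mem_ball_self hpos, hx⟩ ?_
  rwa [Metric.mem_ball, dist_eq_norm]

lemma exists_lipschitzWith_add_mul_infDist {K : ℝ≥0} {G : EuclideanSpace ℝ (Fin d) → ℝ}
    (hG : LipschitzWith K G) (c : ℝ) :
    ∃ L, LipschitzWith L fun x => G x + c * Metric.infDist x (frontier V) := by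
  refine ⟨_, hG.add (LipschitzWith.of_dist_le_mul (K := ‖c‖₊) fun x y => ?_)⟩
  have h := (Metric.lipschitz_infDist_pt (frontier V)).dist_le_mul x y
  rw [NNReal.coe_one, one_mul] at h
  rw [dist_eq_norm, ← mul_sub, norm_mul, ← dist_eq_norm, coe_nnnorm]
  gcongr

lemma exists_lipschitzWith_walkMean [NeZero d] {r : ℝ} (hr : 0 ≤ r) {K : ℝ≥0}
    {φ : EuclideanSpace ℝ (Fin d) → ℝ} (hφ : LipschitzWith K φ) :
    ∃ K', LipschitzWith K' (walkMean V r φ) := by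
  refine ⟨K * (1 + r.toNNReal), LipschitzWith.of_dist_le_mul fun x y => ?_⟩
  have hint : ∀ (x : EuclideanSpace ℝ (Fin d)) (t : ℝ),
      Integrable (fun θ => φ (x + t • θ)) (uniformSphere d) := fun x t =>
    integrable_uniformSphere_of_continuous (hφ.continuous.comp (by fun_prop))
  rw [Real.dist_eq]
  unfold walkMean sphereMean
  rw [← integral_sub (hint _ _) (hint _ _), ← Real.norm_eq_abs]
  refine (norm_integral_le_of_norm_le_const (C := K * (1 + r.toNNReal) * dist x y) ?_).trans
    (by simp)
  filter_upwards [ae_norm_eq_one_uniformSphere d] with θ hθ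
  rw [Real.norm_eq_abs, ← Real.dist_eq, mul_assoc]
  refine (hφ.dist_le_mul _ _).trans (mul_le_mul_of_nonneg_left ?_ K.2)
  refine (dist_add_add_le _ _ _ _).trans ?_
  have h1 : dist (Metric.infDist x (frontier V)) (Metric.infDist y (frontier V)) ≤ dist x y := by
    simpa using (Metric.lipschitz_infDist_pt (frontier V)).dist_le_mul x y
  rw [dist_eq_norm (_ • θ), ← sub_smul, norm_smul, hθ, mul_one, ← mul_sub, norm_mul,
    Real.norm_of_nonneg hr, ← dist_eq_norm, Real.coe_toNNReal _ hr, add_mul, one_mul]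
  gcongr

lemma exists_lipschitzWith_iterate_walkMean [NeZero d] {r : ℝ} (hr : 0 ≤ r) {K : ℝ≥0}
    {φ : EuclideanSpace ℝ (Fin d) → ℝ} (hφ : LipschitzWith K φ) (n : ℕ) :
    ∃ K', LipschitzWith K' ((walkMean V r)^[n] φ) := by
  induction n with
  | zero => exact ⟨K, hφ⟩
  | succ n ih =>
    obtain ⟨K', hK'⟩ := ih
    rw [Function.iterate_succ_apply']
    exact exists_lipschitzWith_walkMean hr hK'

lemma iterate_walkMean_neg (r : ℝ) (φ : EuclideanSpace ℝ (Fin d) → ℝ) (n : ℕ) :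
    (walkMean V r)^[n] (-φ) = -(walkMean V r)^[n] φ := by
  induction n with
  | zero => rfl
  | succ n ih =>
    rw [Function.iterate_succ_apply', Function.iterate_succ_apply', ih]
    ext x
    simp [walkMean, sphereMean, integral_neg]

/-- If `u` satisfies the mean inequality with a small step `ε` away from the boundary, and dominates
`φ`, then it almost dominates the iterates of `φ` under the transition operator: `n` steps of the
walk from `x` stay at distance `(1 - r) ^ n` times that of `x` from the boundary. Halving `1 - r`
makes room for the overshoot `ε` of the small steps. The constant `c` does not depend on `u`
or `ε`. -/
lemma exists_iterate_walkMean_sub_le [NeZero d] (hV : IsOpen V) {r : ℝ} (hr : r ∈ Ioo (0 : ℝ) 1)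
    {K : ℝ≥0} {φ : EuclideanSpace ℝ (Fin d) → ℝ} (hφ : LipschitzWith K φ) (n : ℕ) :
    ∃ c : ℝ, ∀ (u : EuclideanSpace ℝ (Fin d) → ℝ) (C η ε : ℝ), Measurable u →
      (∀ x, |u x| ≤ C) → 0 < ε → ε ≤ η → (∀ y ∈ V, φ y ≤ u y) →
      (∀ y ∈ V, η < Metric.infDist y (frontier V) → sphereMean ε u y ≤ u y) →
      ∀ x ∈ V, η < ((1 - r) / 2) ^ n * Metric.infDist x (frontier V) →
        (walkMean V r)^[n] φ x - c * ε ≤ u x := by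
  obtain ⟨hr0, hr1⟩ := hr
  induction n with
  | zero =>
    refine ⟨0, fun u C η ε _ _ _ _ hφu _ x hx _ => ?_⟩
    simpa using hφu x hx
  | succ n ih =>
    obtain ⟨c, hc⟩ := ih
    obtain ⟨K', hK'⟩ := exists_lipschitzWith_iterate_walkMean (V := V) hr0.le hφ n
    set ψ := (walkMean V r)^[n] φ with hψ
    refine ⟨c + K', fun u C η ε hu hC hε hεη hφu hmean x hx hxd => ?_⟩
    have hIH := hc u C η ε hu hC hε hεη hφu hmean
    set δ := Metric.infDist x (frontier V) with hδ
    set κ := (1 - r) / 2 with hκ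
    have hκ0 : 0 < κ := by rw [hκ]; linarith
    have hκ1 : κ ≤ 1 := by rw [hκ]; linarith
    have hrκ : r = 1 - 2 * κ := by rw [hκ]; ring
    have hδ0 : 0 < δ := by
      have h1 : 0 < κ ^ (n + 1) * δ := (hε.trans_le hεη).trans hxd
      exact pos_of_mul_pos_right h1 (by positivity)
    have hηκ : η < κ * δ := by
      refine hxd.trans_le (mul_le_mul_of_nonneg_right ?_ hδ0.le)
      rw [pow_succ]
      exact mul_le_of_le_one_left hκ0.le (pow_le_one₀ hκ0.le hκ1)
    have hdist : ∀ y, δ - ‖y - x‖ ≤ Metric.infDist y (frontier V) := by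
      intro y
      have := Metric.infDist_le_infDist_add_dist (s := frontier V) (x := x) (y := y)
      rw [dist_comm, dist_eq_norm] at this
      linarith
    have hmem : ∀ y, ‖y - x‖ < r * δ + ε → y ∈ V := fun y hy =>
      mem_of_norm_sub_lt_infDist_frontier hV hx (by
        rw [hrκ] at hy
        have : 0 < κ * δ := by positivity
        nlinarith)
    have key := sphereMean_sub_le_of_sphereMean_le (φ := fun y => ψ y - c * ε) (x := x)
      (R := r * δ) hu hC (by simpa using hK'.sub (LipschitzWith.const (c * ε)))
      (by positivity) hε
      (fun y hy => hmean y (hmem y (by linarith)) (by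
        have := hdist y
        rw [hrκ] at hy
        nlinarith))
      (fun y _ hy => hIH y (hmem y hy) (by
        have h1 := hdist y
        have h2 : κ * δ ≤ Metric.infDist y (frontier V) := by
          rw [hrκ] at hy
          nlinarith
        calc η < κ ^ (n + 1) * δ := hxd
          _ = κ ^ n * (κ * δ) := by ring
          _ ≤ κ ^ n * Metric.infDist y (frontier V) := by gcongr))
    have hsub : sphereMean (r * δ) (fun y => ψ y - c * ε) x = walkMean V r ψ x - c * ε := by
      have hint : Integrable (fun θ => ψ (x + (r * δ) • θ)) (uniformSphere d) :=
        integrable_uniformSphere_of_continuous (hK'.continuous.comp (by fun_prop))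
      simp only [walkMean, sphereMean, ← hδ]
      rw [integral_sub hint (integrable_const _)]
      simp
    rw [Function.iterate_succ_apply', ← hψ]
    rw [hsub] at key
    linarith

/-- The function `u` is the supremum of the expected payoffs `G` of the walk with steps of constant
length `ε` and uniform directions, stopped within distance `δ` of the boundary or at a finite time.
The mean inequality for `G` makes these payoffs increase with time. -/
lemma exists_sphereMean_eq_of_lt_infDist [NeZero d] (hV : IsOpen V)
    {G : EuclideanSpace ℝ (Fin d) → ℝ} (hG : Measurable G) {C : ℝ} (hG0 : ∀ x, 0 ≤ G x)
    (hGC : ∀ x, G x ≤ C) {δ ε : ℝ}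
    (hsub : ∀ y ∈ V, δ < Metric.infDist y (frontier V) → G y ≤ sphereMean ε G y) :
    ∃ u : EuclideanSpace ℝ (Fin d) → ℝ, Measurable u ∧ (∀ x, G x ≤ u x) ∧ (∀ x, u x ≤ C) ∧
      (∀ y ∈ V, δ < Metric.infDist y (frontier V) → sphereMean ε u y = u y) ∧
      (∀ y ∈ V, Metric.infDist y (frontier V) ≤ δ → u y = G y) := by
  classical
  set D : Set (EuclideanSpace ℝ (Fin d)) := V ∩ {y | δ < Metric.infDist y (frontier V)} with hD
  have hDm : MeasurableSet D := hV.measurableSet.inter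
    (measurableSet_lt measurable_const (Metric.continuous_infDist_pt _).measurable)
  set T : (EuclideanSpace ℝ (Fin d) → ℝ) → EuclideanSpace ℝ (Fin d) → ℝ :=
    fun φ => D.piecewise (sphereMean ε φ) φ with hT
  have hTD : ∀ φ, ∀ y ∈ D, T φ y = sphereMean ε φ y := fun φ y hy => piecewise_eq_of_mem _ _ _ hy
  have hTn : ∀ φ, ∀ y ∉ D, T φ y = φ y := fun φ y hy => piecewise_eq_of_notMem _ _ _ hy
  set f : ℕ → EuclideanSpace ℝ (Fin d) → ℝ := fun k => T^[k] G with hf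
  have hsucc : ∀ k, f (k + 1) = T (f k) := fun k => Function.iterate_succ_apply' _ _ _
  have habs : ∀ φ : EuclideanSpace ℝ (Fin d) → ℝ, (∀ x, 0 ≤ φ x) → (∀ x, φ x ≤ C) →
      ∀ x, |φ x| ≤ C := fun φ h0 hC x => by rw [abs_of_nonneg (h0 x)]; exact hC x
  have hmain : ∀ k, Measurable (f k) ∧ (∀ x, G x ≤ f k x) ∧ (∀ x, f k x ≤ C) ∧
      ∀ x, f k x ≤ f (k + 1) x := by
    intro k
    induction k with
    | zero =>
      refine ⟨hG, fun _ => le_rfl, hGC, fun x => ?_⟩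
      rw [hsucc]
      by_cases hx : x ∈ D
      · rw [hTD _ x hx]
        exact hsub x hx.1 hx.2
      · rw [hTn _ x hx]
    | succ k ih =>
      obtain ⟨hm, hGk, hkC, hmono⟩ := ih
      have hm' : Measurable (f (k + 1)) := by
        rw [hsucc]
        exact (measurable_sphereMean hm measurable_const measurable_id).piecewise hDm hm
      have hkC' : ∀ x, f (k + 1) x ≤ C := fun x => by
        rw [hsucc]
        by_cases hx : x ∈ D
        · rw [hTD _ x hx]
          exact (abs_le.1 (abs_sphereMean_le
            (habs _ (fun x => (hG0 x).trans (hGk x)) hkC) ε x)).2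
        · rw [hTn _ x hx]
          exact hkC x
      have hGk' : ∀ x, G x ≤ f (k + 1) x := fun x => (hGk x).trans (hmono x)
      refine ⟨hm', hGk', hkC', fun x => ?_⟩
      have h1 := habs _ (fun x => (hG0 x).trans (hGk x)) hkC
      have h2 := habs _ (fun x => (hG0 x).trans (hGk' x)) hkC'
      rw [hsucc (k + 1)]
      by_cases hx : x ∈ D
      · rw [hTD _ x hx]
        conv_lhs => rw [hsucc, hTD _ x hx]
        exact integral_mono (integrable_of_forall_abs_le (by fun_prop) fun θ => h1 _)
          (integrable_of_forall_abs_le (by fun_prop) fun θ => h2 _) fun θ => hmono _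
      · rw [hTn _ x hx]
  have hbdd : ∀ x, BddAbove (range fun k => f k x) := fun x =>
    ⟨C, by rintro _ ⟨k, rfl⟩; exact (hmain k).2.2.1 x⟩
  have hlim : ∀ x, Tendsto (fun k => f k x) atTop (𝓝 (⨆ k, f k x)) := fun x =>
    tendsto_atTop_ciSup (monotone_nat_of_le_succ fun k => (hmain k).2.2.2 x) (hbdd x)
  refine ⟨fun x => ⨆ k, f k x, measurable_of_tendsto_metrizable (fun k => (hmain k).1)
    (tendsto_pi_nhds.2 hlim), fun x => le_ciSup (hbdd x) 0,
    fun x => ciSup_le fun k => (hmain k).2.2.1 x, fun y hy hyδ => ?_, fun y hy hyδ => ?_⟩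
  · have h1 : Tendsto (fun k => sphereMean ε (f k) y) atTop
        (𝓝 (sphereMean ε (fun x => ⨆ k, f k x) y)) := by
      refine tendsto_integral_of_dominated_convergence (fun _ => C)
        (fun k => ((hmain k).1.comp (by fun_prop)).aestronglyMeasurable) (integrable_const _)
        (fun k => ae_of_all _ fun θ => ?_) (ae_of_all _ fun θ => hlim _)
      exact habs _ (fun x => (hG0 x).trans ((hmain k).2.1 x)) (hmain k).2.2.1 _
    refine tendsto_nhds_unique h1 (((hlim y).comp (tendsto_add_atTop_nat 1)).congr fun k => ?_)
    simp only [Function.comp]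
    rw [hsucc, hTD _ y ⟨hy, hyδ⟩]
  · have hyD : y ∉ D := fun h => not_lt.2 hyδ h.2
    have : ∀ k, f k y = G y := by
      intro k
      induction k with
      | zero => rfl
      | succ k ih => rw [hsucc, hTn _ y hyD, ih]
    simp [this]

/-- The step common to the walks with ratios `r` and `s`: for a bounded function `G` with the mean
inequality in `V`, the `n`-th mean for the ratio `r` is at most the `m`-th mean for the ratio `s`,
corrected by a multiple of the distance to the boundary that depends on `n` only. Both means are
compared with the value function of the walk with tiny steps `ε → 0` stopped near the boundary. -/
lemma iterate_walkMean_le_iterate_walkMean [NeZero d] (hV : IsOpen V)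
    {G : EuclideanSpace ℝ (Fin d) → ℝ} {K : ℝ≥0} (hG : LipschitzWith K G) {C : ℝ}
    (hG0 : ∀ x, 0 ≤ G x) (hGC : ∀ x, G x ≤ C)
    (hsub : ∀ y ∈ V, ∀ ε, 0 < ε → ε < Metric.infDist y (frontier V) → G y ≤ sphereMean ε G y)
    {r s : ℝ} (hr : r ∈ Ioo (0 : ℝ) 1) (hs : s ∈ Ioo (0 : ℝ) 1) {v : EuclideanSpace ℝ (Fin d)}
    (hv : v ∈ V) {n : ℕ} {δ : ℝ} (hδ : 0 < δ)
    (hδn : δ < ((1 - r) / 2) ^ n * Metric.infDist v (frontier V)) (m : ℕ) :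
    (walkMean V r)^[n] G v ≤
      (walkMean V s)^[m] (fun x => G x + C / δ * Metric.infDist x (frontier V)) v := by
  have hC0 : 0 ≤ C := (hG0 v).trans (hGC v)
  set ψ : EuclideanSpace ℝ (Fin d) → ℝ := fun x => G x + C / δ * Metric.infDist x (frontier V)
    with hψ
  obtain ⟨L, hL⟩ : ∃ L, LipschitzWith L ψ := exists_lipschitzWith_add_mul_infDist hG (C / δ)
  obtain ⟨c₁, hc₁⟩ := exists_iterate_walkMean_sub_le hV hr hG n
  obtain ⟨c₂, hc₂⟩ := exists_iterate_walkMean_sub_le hV hs hL.neg m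
  have hdv : 0 < Metric.infDist v (frontier V) := by
    refine pos_of_mul_pos_right (hδ.trans hδn) (pow_nonneg ?_ _)
    linarith [hr.2]
  set e := ((1 - s) / 2) ^ m * Metric.infDist v (frontier V) with he
  have he0 : 0 < e := mul_pos (pow_pos (by linarith [hs.2]) _) hdv
  have hev : ∀ ε, 0 < ε → ε ≤ δ → ε < e →
      (walkMean V r)^[n] G v ≤ (walkMean V s)^[m] ψ v + (c₁ + c₂) * ε := by
    intro ε hε hεδ hεe
    obtain ⟨u, hum, hGu, huC, hueq, hustop⟩ := exists_sphereMean_eq_of_lt_infDist (δ := δ) (ε := ε)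
      hV hG.continuous.measurable hG0 hGC fun y hy hyδ => hsub y hy ε hε (hεδ.trans_lt hyδ)
    have huabs : ∀ x, |u x| ≤ C := fun x => by
      rw [abs_of_nonneg ((hG0 x).trans (hGu x))]
      exact huC x
    have h1 := hc₁ u C δ ε hum huabs hε hεδ (fun y _ => hGu y)
      (fun y hy hyδ => (hueq y hy hyδ).le) v hv hδn
    have h2 := hc₂ (fun y => -u y) C ε ε hum.neg (fun x => by rw [abs_neg]; exact huabs x) hε le_rfl
      (fun y hy => ?_) (fun y hy hyε => ?_) v hv hεe
    · rw [iterate_walkMean_neg] at h2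
      simp only [Pi.neg_apply] at h2
      linarith
    · simp only [Pi.neg_apply, neg_le_neg_iff, hψ]
      have h0 : 0 ≤ Metric.infDist y (frontier V) := Metric.infDist_nonneg
      rcases le_or_gt (Metric.infDist y (frontier V)) δ with hyδ | hyδ
      · rw [hustop y hy hyδ]
        have : 0 ≤ C / δ * Metric.infDist y (frontier V) := by positivity
        linarith
      · have : C / δ * δ ≤ C / δ * Metric.infDist y (frontier V) := by gcongr
        rw [div_mul_cancel₀ _ hδ.ne'] at this
        linarith [huC y, hG0 y]
    · have hle : u y ≤ sphereMean ε u y := by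
        rcases le_or_gt (Metric.infDist y (frontier V)) δ with hyδ | hyδ
        · rw [hustop y hy hyδ]
          refine (hsub y hy ε hε hyε).trans (sphereMean_mono hε.le ?_ ?_ fun z _ => hGu z)
          · exact integrable_uniformSphere_of_continuous (hG.continuous.comp (by fun_prop))
          · exact integrable_of_forall_abs_le (by fun_prop) fun θ => huabs _
        · exact (hueq y hy hyδ).ge
      unfold sphereMean at hle ⊢
      rw [integral_neg]
      linarith
  have hlim : Tendsto (fun ε => (walkMean V s)^[m] ψ v + (c₁ + c₂) * ε) (𝓝[>] 0)
      (𝓝 ((walkMean V s)^[m] ψ v)) := by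
    have : Continuous fun ε : ℝ => (walkMean V s)^[m] ψ v + (c₁ + c₂) * ε := by fun_prop
    simpa using (this.tendsto 0).mono_left nhdsWithin_le_nhds
  refine ge_of_tendsto hlim ?_
  filter_upwards [Ioo_mem_nhdsGT (lt_min hδ he0)] with ε hε
  exact hev ε hε.1 (hε.2.le.trans (min_le_left _ _)) (hε.2.trans_le (min_le_right _ _))

end WalkMean

/-! ### The walk as a bounded martingale -/

section Walk

open scoped RealInnerProductSpace NNReal

variable {d : ℕ} {Ω : Type*} {V : Set (EuclideanSpace ℝ (Fin d))}
  {ϑ : ℕ → Ω → EuclideanSpace ℝ (Fin d)} {r : ℝ} {v : EuclideanSpace ℝ (Fin d)}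

/-- The directions `ϑ 0, ϑ 1, …` are independent and uniformly distributed on the unit sphere. -/
structure IsUniformDirections [MeasurableSpace Ω] (P : Measure Ω)
    (ϑ : ℕ → Ω → EuclideanSpace ℝ (Fin d)) : Prop where
  measurable : ∀ n, Measurable (ϑ n)
  iIndepFun : iIndepFun ϑ P
  map_eq : ∀ n, Measure.map (ϑ n) P = uniformSphere d

/-- The walk at time `n` is measurable for every `σ`-algebra that makes the first `n` directions
measurable. -/
lemma measurable_walk {m : MeasurableSpace Ω} {n : ℕ} (h : ∀ i < n, Measurable (ϑ i)) :
    Measurable (walk V ϑ r v n) := by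
  induction n with
  | zero => exact measurable_const
  | succ n ih =>
    have h1 := ih fun i hi => h i (hi.trans n.lt_succ_self)
    have h2 : Measurable fun ω => Metric.infDist (walk V ϑ r v n ω) (frontier V) :=
      (Metric.continuous_infDist_pt _).measurable.comp h1
    exact h1.add ((h2.const_mul r).smul (h n n.lt_succ_self))

lemma frontier_nonempty_of_isBounded [NeZero d] (hb : Bornology.IsBounded V) (hv : v ∈ V) :
    (frontier V).Nonempty := by
  refine nonempty_frontier_iff.2 ⟨⟨v, hv⟩, fun h => ?_⟩
  exact NormedSpace.unbounded_univ ℝ (EuclideanSpace ℝ (Fin d)) (h ▸ hb)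

lemma infDist_frontier_pos [NeZero d] (hV : IsOpen V) (hb : Bornology.IsBounded V) (hv : v ∈ V) :
    0 < Metric.infDist v (frontier V) := by
  refine (isClosed_frontier.notMem_iff_infDist_pos (frontier_nonempty_of_isBounded hb hv)).1 ?_
  rw [hV.frontier_eq]
  exact fun h => h.2 hv

/-- The `σ`-algebra at time `n` is generated by the first `n` directions. -/
def pastFiltration {m : MeasurableSpace Ω} (h : ∀ n, Measurable (ϑ n)) : Filtration ℕ m where
  seq n := ⨆ i ∈ Iio n, MeasurableSpace.comap (ϑ i) inferInstance
  mono' _ _ hab := biSup_mono fun _ hi => lt_of_lt_of_le hi hab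
  le' _ := iSup₂_le fun i _ => (h i).comap_le

lemma measurable_walk_pastFiltration {m : MeasurableSpace Ω} (h : ∀ n, Measurable (ϑ n)) (n : ℕ) :
    Measurable[pastFiltration h n] (walk V ϑ r v n) :=
  measurable_walk fun i hi => Measurable.of_comap_le
    (le_iSup₂ (f := fun i (_ : i ∈ Iio n) => MeasurableSpace.comap (ϑ i) inferInstance) i hi)

variable [MeasurableSpace Ω] {P : Measure Ω}

namespace IsUniformDirections

lemma indep_pastFiltration (h : IsUniformDirections P ϑ) (n : ℕ) :
    Indep (pastFiltration h.measurable n) (MeasurableSpace.comap (ϑ n) inferInstance) P := by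
  have := indep_iSup_of_disjoint (fun i => (h.measurable i).comap_le) h.iIndepFun.iIndep
    (S := Iio n) (T := {n}) (by simp)
  rwa [iSup_singleton] at this

lemma indepFun_walk (h : IsUniformDirections P ϑ) (n : ℕ) :
    IndepFun (walk V ϑ r v n) (ϑ n) P := by
  rw [IndepFun_iff_Indep]
  exact indep_of_indep_of_le_left (h.indep_pastFiltration n)
    (measurable_walk_pastFiltration h.measurable n).comap_le

lemma ae_norm_eq_one (h : IsUniformDirections P ϑ) : ∀ᵐ ω ∂P, ∀ n, ‖ϑ n ω‖ = 1 := by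
  rw [ae_all_iff]
  intro n
  have := ae_norm_eq_one_uniformSphere d
  rw [← h.map_eq n] at this
  exact ae_of_ae_map (h.measurable n).aemeasurable this

lemma ae_walk_mem [NeZero d] (h : IsUniformDirections P ϑ) (hV : IsOpen V)
    (hb : Bornology.IsBounded V) (hr : r ∈ Ioo (0 : ℝ) 1) (hv : v ∈ V) :
    ∀ᵐ ω ∂P, ∀ n, walk V ϑ r v n ω ∈ V := by
  filter_upwards [h.ae_norm_eq_one] with ω hω n
  induction n with
  | zero => exact hv
  | succ n ih =>
    have hpos := infDist_frontier_pos hV hb ih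
    refine mem_of_norm_sub_lt_infDist_frontier hV ih ?_
    rw [walk, add_sub_cancel_left, norm_smul, hω n, mul_one,
      Real.norm_of_nonneg (mul_nonneg hr.1.le hpos.le)]
    nlinarith [hr.2]

lemma ae_norm_comp_walk_le [NeZero d] (h : IsUniformDirections P ϑ) (hV : IsOpen V)
    (hb : Bornology.IsBounded V) (hr : r ∈ Ioo (0 : ℝ) 1) (hv : v ∈ V)
    {F : EuclideanSpace ℝ (Fin d) → ℝ} (hF : Continuous F) :
    ∃ C, ∀ᵐ ω ∂P, ∀ n, ‖F (walk V ϑ r v n ω)‖ ≤ C := by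
  obtain ⟨C, hC⟩ := hb.isCompact_closure.exists_bound_of_continuousOn hF.continuousOn
  refine ⟨C, ?_⟩
  filter_upwards [h.ae_walk_mem hV hb hr hv] with ω hω n
  exact hC _ (subset_closure (hω n))

lemma integrable_comp_walk [NeZero d] [IsProbabilityMeasure P] (h : IsUniformDirections P ϑ)
    (hV : IsOpen V) (hb : Bornology.IsBounded V) (hr : r ∈ Ioo (0 : ℝ) 1) (hv : v ∈ V)
    {F : EuclideanSpace ℝ (Fin d) → ℝ} (hF : Continuous F) (n : ℕ) :
    Integrable (fun ω => F (walk V ϑ r v n ω)) P := by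
  obtain ⟨C, hC⟩ := h.ae_norm_comp_walk_le hV hb hr hv hF
  refine Integrable.of_bound (hF.measurable.comp
    (measurable_walk fun i _ => h.measurable i)).aestronglyMeasurable C ?_
  filter_upwards [hC] with ω hω using hω n

/-- Markov property: expectations along the walk are the iterates of its transition operator. -/
lemma integral_comp_walk [NeZero d] [IsProbabilityMeasure P] (h : IsUniformDirections P ϑ)
    (hV : IsOpen V) (hb : Bornology.IsBounded V) (hr : r ∈ Ioo (0 : ℝ) 1) (hv : v ∈ V)
    {K : ℝ≥0} {φ : EuclideanSpace ℝ (Fin d) → ℝ} (hφ : LipschitzWith K φ) (n : ℕ) :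
    ∫ ω, φ (walk V ϑ r v n ω) ∂P = (walkMean V r)^[n] φ v := by
  induction n generalizing φ K with
  | zero => simp [walk]
  | succ n ih =>
    obtain ⟨K', hK'⟩ := exists_lipschitzWith_walkMean (V := V) hr.1.le hφ
    rw [Function.iterate_succ_apply, ← ih hK']
    have hX : Measurable (walk V ϑ r v n) := measurable_walk fun i _ => h.measurable i
    have hprod : P.map (fun ω => (walk V ϑ r v n ω, ϑ n ω)) =
        (P.map (walk V ϑ r v n)).prod (uniformSphere d) := by
      rw [← h.map_eq n]
      exact (indepFun_iff_map_prod_eq_prod_map_map hX.aemeasurable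
        (h.measurable n).aemeasurable).1 (h.indepFun_walk n)
    have hpair : Measurable fun ω => (walk V ϑ r v n ω, ϑ n ω) := hX.prodMk (h.measurable n)
    have : IsProbabilityMeasure (P.map (walk V ϑ r v n)) :=
      Measure.isProbabilityMeasure_map hX.aemeasurable
    set H : EuclideanSpace ℝ (Fin d) × EuclideanSpace ℝ (Fin d) → ℝ :=
      fun p => φ (p.1 + (r * Metric.infDist p.1 (frontier V)) • p.2) with hH
    have hHc : Continuous H := by
      have := Metric.continuous_infDist_pt (frontier V)
      exact hφ.continuous.comp (by fun_prop)
    calc ∫ ω, φ (walk V ϑ r v (n + 1) ω) ∂P = ∫ ω, H (walk V ϑ r v n ω, ϑ n ω) ∂P := rfl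
      _ = ∫ p, H p ∂(P.map (walk V ϑ r v n)).prod (uniformSphere d) := by
        rw [← hprod, integral_map hpair.aemeasurable hHc.aestronglyMeasurable]
      _ = ∫ x, ∫ θ, H (x, θ) ∂uniformSphere d ∂P.map (walk V ϑ r v n) := by
        refine integral_prod _ ?_
        rw [← hprod, integrable_map_measure hHc.aestronglyMeasurable hpair.aemeasurable]
        exact h.integrable_comp_walk hV hb hr hv hφ.continuous (n + 1)
      _ = ∫ ω, walkMean V r φ (walk V ϑ r v n ω) ∂P := by
        rw [integral_map hX.aemeasurable]
        · rfl
        · exact hK'.continuous.aestronglyMeasurable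

lemma integral_inner_eq_zero (h : IsUniformDirections P ϑ) (a : EuclideanSpace ℝ (Fin d)) (n : ℕ) :
    ∫ ω, ⟪a, ϑ n ω⟫ ∂P = 0 := by
  rw [← integral_inner_uniformSphere a, ← h.map_eq n,
    integral_map (h.measurable n).aemeasurable (by fun_prop)]

lemma martingale_inner_walk [NeZero d] [IsProbabilityMeasure P] (h : IsUniformDirections P ϑ)
    (hV : IsOpen V) (hb : Bornology.IsBounded V) (hr : r ∈ Ioo (0 : ℝ) 1) (hv : v ∈ V)
    (a : EuclideanSpace ℝ (Fin d)) :
    Martingale (fun n ω => ⟪a, walk V ϑ r v n ω⟫) (pastFiltration h.measurable) P := by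
  have hdist := Metric.continuous_infDist_pt (frontier V)
  have hint : ∀ n, Integrable (fun ω => ⟪a, walk V ϑ r v n ω⟫) P := fun n =>
    h.integrable_comp_walk hV hb hr hv (F := fun x => ⟪a, x⟫) (by fun_prop) n
  refine martingale_of_condExp_sub_eq_zero_nat (fun n => ?_) hint fun n => ?_
  · exact (Measurable.stronglyMeasurable
      ((by fun_prop : Measurable fun x : EuclideanSpace ℝ (Fin d) => ⟪a, x⟫).comp
        (measurable_walk_pastFiltration h.measurable n)))
  · have hinc : (fun ω => ⟪a, walk V ϑ r v (n + 1) ω⟫) - (fun ω => ⟪a, walk V ϑ r v n ω⟫) =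
        (fun ω => r * Metric.infDist (walk V ϑ r v n ω) (frontier V)) *
          fun ω => ⟪a, ϑ n ω⟫ := by
      ext ω
      simp only [Pi.sub_apply, Pi.mul_apply, walk, inner_add_right, real_inner_smul_right]
      ring
    have hϑint : Integrable (fun ω => ⟪a, ϑ n ω⟫) P := by
      have := integrable_inner_uniformSphere a
      rw [← h.map_eq n, integrable_map_measure (by fun_prop) (h.measurable n).aemeasurable] at this
      exact this
    have hfm : StronglyMeasurable[pastFiltration h.measurable n]
        (fun ω => r * Metric.infDist (walk V ϑ r v n ω) (frontier V)) :=
      Measurable.stronglyMeasurable ((hdist.const_mul r).measurable.comp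
        (measurable_walk_pastFiltration h.measurable n))
    have hind := condExp_indep_eq (f := fun ω => ⟪a, ϑ n ω⟫) (h.measurable n).comap_le
      ((pastFiltration h.measurable).le n)
      (Measurable.stronglyMeasurable
        ((by fun_prop : Measurable fun x : EuclideanSpace ℝ (Fin d) => ⟪a, x⟫).comp
          (comap_measurable (ϑ n))))
      (h.indep_pastFiltration n).symm
    rw [hinc]
    refine (condExp_mul_of_stronglyMeasurable_left hfm ?_ hϑint).trans ?_
    · rw [← hinc]
      exact (hint (n + 1)).sub (hint n)
    · filter_upwards [hind] with ω hω
      rw [Pi.mul_apply, hω, h.integral_inner_eq_zero]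
      simp

/-- The walk converges almost surely by martingale convergence. Its increments, of length
`r * infDist (walk n) (frontier V)`, tend to zero, so that the limit is on the boundary. -/
lemma ae_tendsto_walkLimit [NeZero d] [IsProbabilityMeasure P] (h : IsUniformDirections P ϑ)
    (hV : IsOpen V) (hb : Bornology.IsBounded V) (hr : r ∈ Ioo (0 : ℝ) 1) (hv : v ∈ V) :
    ∀ᵐ ω ∂P, Tendsto (fun n => walk V ϑ r v n ω) atTop (𝓝 (walkLimit V ϑ r v ω)) ∧
      walkLimit V ϑ r v ω ∈ frontier V := by
  have hcoord : ∀ a : EuclideanSpace ℝ (Fin d), ∀ᵐ ω ∂P, ∃ c,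
      Tendsto (fun n => ⟪a, walk V ϑ r v n ω⟫) atTop (𝓝 c) := by
    intro a
    obtain ⟨C, hC⟩ := h.ae_norm_comp_walk_le hV hb hr hv (F := fun x => ⟪a, x⟫) (by fun_prop)
    refine (h.martingale_inner_walk hV hb hr hv a).submartingale.exists_ae_tendsto_of_bdd
      (R := C.toNNReal) fun n => ?_
    refine (eLpNorm_le_of_ae_bound (C := C) ?_).trans ?_
    · filter_upwards [hC] with ω hω using hω n
    · simp [ENNReal.ofReal]
  have hall : ∀ᵐ ω ∂P, ∀ i : Fin d, ∃ c,
      Tendsto (fun n => ⟪EuclideanSpace.basisFun (Fin d) ℝ i, walk V ϑ r v n ω⟫) atTop (𝓝 c) :=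
    ae_all_iff.2 fun i => hcoord _
  filter_upwards [hall, h.ae_norm_eq_one] with ω hω hnorm
  choose c hc using hω
  have hlim : Tendsto (fun n => walk V ϑ r v n ω) atTop
      (𝓝 (∑ i, c i • EuclideanSpace.basisFun (Fin d) ℝ i)) := by
    refine (tendsto_finsetSum Finset.univ fun i _ =>
      (hc i).smul_const (EuclideanSpace.basisFun (Fin d) ℝ i)).congr fun n => ?_
    exact (EuclideanSpace.basisFun (Fin d) ℝ).sum_repr' _
  have hL : Tendsto (fun n => walk V ϑ r v n ω) atTop (𝓝 (walkLimit V ϑ r v ω)) :=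
    tendsto_nhds_limUnder ⟨_, hlim⟩
  refine ⟨hL, ?_⟩
  have h1 : Tendsto (fun n => ‖walk V ϑ r v (n + 1) ω - walk V ϑ r v n ω‖) atTop (𝓝 0) := by
    simpa using ((hL.comp (tendsto_add_atTop_nat 1)).sub hL).norm
  have h2 : Tendsto (fun n => ‖walk V ϑ r v (n + 1) ω - walk V ϑ r v n ω‖) atTop
      (𝓝 (r * Metric.infDist (walkLimit V ϑ r v ω) (frontier V))) := by
    refine ((((Metric.continuous_infDist_pt (frontier V)).tendsto _).comp hL).const_mul r).congr
      fun n => ?_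
    rw [walk, add_sub_cancel_left, norm_smul, hnorm n, mul_one,
      Real.norm_of_nonneg (mul_nonneg hr.1.le Metric.infDist_nonneg)]
    rfl
  have h3 := tendsto_nhds_unique h2 h1
  rw [mul_eq_zero, or_iff_right hr.1.ne'] at h3
  exact (isClosed_frontier.mem_iff_infDist_zero (frontier_nonempty_of_isBounded hb hv)).2 h3

lemma aemeasurable_walkLimit [NeZero d] [IsProbabilityMeasure P] (h : IsUniformDirections P ϑ)
    (hV : IsOpen V) (hb : Bornology.IsBounded V) (hr : r ∈ Ioo (0 : ℝ) 1) (hv : v ∈ V) :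
    AEMeasurable (walkLimit V ϑ r v) P := by
  refine aemeasurable_of_tendsto_metrizable_ae (f := walk V ϑ r v) atTop
    (fun n => (measurable_walk fun i _ => h.measurable i).aemeasurable) ?_
  filter_upwards [h.ae_tendsto_walkLimit hV hb hr hv] with ω hω using hω.1

lemma tendsto_integral_comp_walk [NeZero d] [IsProbabilityMeasure P]
    (h : IsUniformDirections P ϑ) (hV : IsOpen V) (hb : Bornology.IsBounded V)
    (hr : r ∈ Ioo (0 : ℝ) 1) (hv : v ∈ V) {F : EuclideanSpace ℝ (Fin d) → ℝ} (hF : Continuous F) :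
    Tendsto (fun n => ∫ ω, F (walk V ϑ r v n ω) ∂P) atTop
      (𝓝 (∫ ω, F (walkLimit V ϑ r v ω) ∂P)) := by
  obtain ⟨C, hC⟩ := h.ae_norm_comp_walk_le hV hb hr hv hF
  refine tendsto_integral_of_dominated_convergence (fun _ => C)
    (fun n => (h.integrable_comp_walk hV hb hr hv hF n).aestronglyMeasurable)
    (integrable_const _) (fun n => ?_) ?_
  · filter_upwards [hC] with ω hω using hω n
  · filter_upwards [h.ae_tendsto_walkLimit hV hb hr hv] with ω hω
    exact (hF.tendsto _).comp hω.1

end IsUniformDirections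

/-! ### The law of the limit -/

/-- Capping the exponent makes `x ↦ exp ⟪a, x⟫` bounded and Lipschitz. -/
lemma exists_lipschitzWith_exp_min_inner (a : EuclideanSpace ℝ (Fin d)) (B : ℝ) :
    ∃ K, LipschitzWith K fun x => Real.exp (min ⟪a, x⟫ B) := by
  have hle : ∀ s t : ℝ, Real.exp (min s B) - Real.exp (min t B) ≤ Real.exp B * |s - t| := by
    intro s t
    have h1 := Real.add_one_le_exp (min t B - min s B)
    have h2 : Real.exp (min t B) = Real.exp (min s B) * Real.exp (min t B - min s B) := by
      rw [← Real.exp_add]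
      congr 1
      ring
    have h3 : Real.exp (min s B) ≤ Real.exp B := Real.exp_le_exp.2 (min_le_right _ _)
    have h4 : min s B - min t B ≤ |s - t| := by
      refine (le_abs_self _).trans ?_
      simpa using abs_min_sub_min_le_max s B t B
    have h5 : Real.exp (min s B) - Real.exp (min t B) ≤
        Real.exp (min s B) * (min s B - min t B) := by
      rw [h2]
      nlinarith [Real.exp_pos (min s B)]
    calc _ ≤ Real.exp (min s B) * (min s B - min t B) := h5
      _ ≤ Real.exp (min s B) * |s - t| := by gcongr
      _ ≤ Real.exp B * |s - t| := by gcongr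
  refine ⟨(Real.exp B * ‖a‖).toNNReal, LipschitzWith.of_dist_le_mul fun x y => ?_⟩
  rw [Real.coe_toNNReal _ (by positivity), Real.dist_eq, dist_eq_norm, mul_assoc]
  have h1 : |⟪a, x⟫ - ⟪a, y⟫| ≤ ‖a‖ * ‖x - y‖ := by
    rw [← inner_sub_right]
    exact abs_real_inner_le_norm _ _
  have h2 : |Real.exp (min ⟪a, x⟫ B) - Real.exp (min ⟪a, y⟫ B)| ≤
      Real.exp B * |⟪a, x⟫ - ⟪a, y⟫| :=
    abs_le.2 ⟨by have := hle ⟪a, y⟫ ⟪a, x⟫; rw [abs_sub_comm] at this; linarith, hle _ _⟩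
  exact h2.trans (mul_le_mul_of_nonneg_left h1 (Real.exp_pos _).le)

/-- The exponential of a linear form lies below its spherical means, because `1 + t ≤ exp t` and
the linear form has mean zero. -/
lemma exp_inner_le_integral [NeZero d] (a y : EuclideanSpace ℝ (Fin d)) (ε : ℝ) :
    Real.exp ⟪a, y⟫ ≤ ∫ θ, Real.exp ⟪a, y + ε • θ⟫ ∂uniformSphere d := by
  have h1 : Real.exp ⟪a, y⟫ =
      ∫ θ, Real.exp ⟪a, y⟫ * (1 + ε * ⟪a, θ⟫) ∂uniformSphere d := by
    rw [integral_const_mul, integral_add (integrable_const _)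
      ((integrable_inner_uniformSphere a).const_mul ε), integral_const_mul,
      integral_inner_uniformSphere]
    simp
  rw [h1]
  refine integral_mono (((integrable_const _).add
    ((integrable_inner_uniformSphere a).const_mul ε)).const_mul _)
    (integrable_uniformSphere_of_continuous (by fun_prop)) fun θ => ?_
  simp only [inner_add_right, real_inner_smul_right, Real.exp_add]
  gcongr
  linarith [Real.add_one_le_exp (ε * ⟪a, θ⟫)]

lemma exists_inner_le_of_mem_closure (hb : Bornology.IsBounded V)
    (a : EuclideanSpace ℝ (Fin d)) : ∃ B, ∀ x ∈ closure V, ⟪a, x⟫ ≤ B := by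
  obtain ⟨B, hB⟩ := hb.isCompact_closure.exists_bound_of_continuousOn
    (f := fun x => ⟪a, x⟫) (by fun_prop)
  exact ⟨B, fun x hx => (le_abs_self _).trans (hB x hx)⟩

namespace IsUniformDirections

lemma integral_exp_inner_walkLimit_le [NeZero d] [IsProbabilityMeasure P]
    (h : IsUniformDirections P ϑ) (hV : IsOpen V) (hb : Bornology.IsBounded V) {r s : ℝ}
    (hr : r ∈ Ioo (0 : ℝ) 1) (hs : s ∈ Ioo (0 : ℝ) 1) (hv : v ∈ V)
    (a : EuclideanSpace ℝ (Fin d)) :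
    ∫ ω, Real.exp ⟪a, walkLimit V ϑ r v ω⟫ ∂P ≤ ∫ ω, Real.exp ⟪a, walkLimit V ϑ s v ω⟫ ∂P := by
  obtain ⟨B, hB⟩ := exists_inner_le_of_mem_closure hb a
  set G : EuclideanSpace ℝ (Fin d) → ℝ := fun x => Real.exp (min ⟪a, x⟫ B) with hG
  obtain ⟨K, hK⟩ : ∃ K, LipschitzWith K G := exists_lipschitzWith_exp_min_inner a B
  have hGeq : ∀ x ∈ closure V, G x = Real.exp ⟪a, x⟫ := fun x hx => by
    simp only [hG, min_eq_left (hB x hx)]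
  have hlimeq : ∀ {t : ℝ}, t ∈ Ioo (0 : ℝ) 1 →
      ∫ ω, Real.exp ⟪a, walkLimit V ϑ t v ω⟫ ∂P = ∫ ω, G (walkLimit V ϑ t v ω) ∂P := by
    intro t ht
    refine integral_congr_ae ?_
    filter_upwards [h.ae_tendsto_walkLimit hV hb ht hv] with ω hω
    exact (hGeq _ (frontier_subset_closure hω.2)).symm
  have hsub : ∀ y ∈ V, ∀ ε, 0 < ε → ε < Metric.infDist y (frontier V) →
      G y ≤ sphereMean ε G y := by
    intro y hy ε hε hεy
    rw [hGeq y (subset_closure hy)]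
    refine (exp_inner_le_integral a y ε).trans_eq (integral_congr_ae ?_)
    filter_upwards [ae_norm_eq_one_uniformSphere d] with θ hθ
    refine (hGeq _ (subset_closure (mem_of_norm_sub_lt_infDist_frontier hV hy ?_))).symm
    simpa [norm_smul, hθ, abs_of_pos hε] using hεy
  have hdv := infDist_frontier_pos hV hb hv
  have hn : ∀ n, ∫ ω, G (walk V ϑ r v n ω) ∂P ≤ ∫ ω, G (walkLimit V ϑ s v ω) ∂P := by
    intro n
    rw [h.integral_comp_walk hV hb hr hv hK n]
    set δ := ((1 - r) / 2) ^ n * Metric.infDist v (frontier V) / 2 with hδ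
    have hpos : 0 < ((1 - r) / 2) ^ n * Metric.infDist v (frontier V) :=
      mul_pos (pow_pos (by linarith [hr.2]) _) hdv
    have hδ0 : 0 < δ := half_pos hpos
    set ψ : EuclideanSpace ℝ (Fin d) → ℝ :=
      fun x => G x + Real.exp B / δ * Metric.infDist x (frontier V) with hψ
    obtain ⟨L, hψL⟩ : ∃ L, LipschitzWith L ψ :=
      exists_lipschitzWith_add_mul_infDist hK (Real.exp B / δ)
    have hm : ∀ m, (walkMean V r)^[n] G v ≤ ∫ ω, ψ (walk V ϑ s v m ω) ∂P := by
      intro m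
      rw [h.integral_comp_walk hV hb hs hv hψL m]
      exact iterate_walkMean_le_iterate_walkMean hV hK (fun x => (Real.exp_pos _).le)
        (fun x => Real.exp_le_exp.2 (min_le_right _ _)) hsub hr hs hv hδ0 (half_lt_self hpos) m
    refine (ge_of_tendsto' (h.tendsto_integral_comp_walk hV hb hs hv hψL.continuous) hm).trans_eq
      (integral_congr_ae ?_)
    filter_upwards [h.ae_tendsto_walkLimit hV hb hs hv] with ω hω
    simp [hψ, Metric.infDist_zero_of_mem hω.2]
  rw [hlimeq hr, hlimeq hs]
  exact le_of_tendsto' (h.tendsto_integral_comp_walk hV hb hr hv hK.continuous) hn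

/-- The moment generating functions of all linear forms of the limit do not depend on the ratio.
As the limit is bounded, they extend to entire functions, whose values on the imaginary axis give
the characteristic function. -/
lemma identDistrib_walkLimit [NeZero d] [IsProbabilityMeasure P]
    (h : IsUniformDirections P ϑ) (hV : IsOpen V) (hb : Bornology.IsBounded V) {r s : ℝ}
    (hr : r ∈ Ioo (0 : ℝ) 1) (hs : s ∈ Ioo (0 : ℝ) 1) (hv : v ∈ V) :
    IdentDistrib (walkLimit V ϑ r v) (walkLimit V ϑ s v) P P := by
  have hXr := h.aemeasurable_walkLimit hV hb hr hv
  have hXs := h.aemeasurable_walkLimit hV hb hs hv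
  refine ⟨hXr, hXs, ?_⟩
  have := Measure.isProbabilityMeasure_map hXr
  have := Measure.isProbabilityMeasure_map hXs
  refine Measure.ext_of_charFun (funext fun ξ => ?_)
  have hmgf : mgf (fun ω => ⟪ξ, walkLimit V ϑ r v ω⟫) P =
      mgf (fun ω => ⟪ξ, walkLimit V ϑ s v ω⟫) P := by
    ext t
    simp only [mgf, ← real_inner_smul_left]
    exact le_antisymm (h.integral_exp_inner_walkLimit_le hV hb hr hs hv _)
      (h.integral_exp_inner_walkLimit_le hV hb hs hr hv _)
  have hset : integrableExpSet (fun ω => ⟪ξ, walkLimit V ϑ r v ω⟫) P = univ := by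
    refine eq_univ_of_forall fun t => ?_
    obtain ⟨B, hB⟩ := exists_inner_le_of_mem_closure hb (t • ξ)
    have hm : AEMeasurable (fun ω => Real.exp (t * ⟪ξ, walkLimit V ϑ r v ω⟫)) P := by fun_prop
    refine Integrable.of_bound hm.aestronglyMeasurable (Real.exp B) ?_
    filter_upwards [h.ae_tendsto_walkLimit hV hb hr hv] with ω hω
    rw [Real.norm_of_nonneg (Real.exp_pos _).le, ← real_inner_smul_left]
    exact Real.exp_le_exp.2 (hB _ (frontier_subset_closure hω.2))
  have hchar : ∀ {X : Ω → EuclideanSpace ℝ (Fin d)}, AEMeasurable X P →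
      charFun (P.map X) ξ = complexMGF (fun ω => ⟪ξ, X ω⟫) P Complex.I := by
    intro X hX
    rw [charFun_apply, integral_map hX (by fun_prop), complexMGF]
    simp only [real_inner_comm ξ, mul_comm Complex.I]
  rw [hchar hXr, hchar hXs]
  exact eqOn_complexMGF_of_mgf hmgf (by simp [hset])

end IsUniformDirections

end Walk

end WalkOnSpheres

theorem mainTheorem5 {d : ℕ} (hd : 1 ≤ d)
    {Ω : Type*} [MeasurableSpace Ω] (P : Measure Ω) [IsProbabilityMeasure P]
    (ϑ : ℕ → Ω → EuclideanSpace ℝ (Fin d))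
    (hmeas : ∀ n, Measurable (ϑ n))
    (hindep : iIndepFun ϑ P)
    (hlaw : ∀ n, Measure.map (ϑ n) P = WalkOnSpheres.uniformSphere d)
    (V : Set (EuclideanSpace ℝ (Fin d)))
    (hne : V.Nonempty) (hopen : IsOpen V) (hbdd : Bornology.IsBounded V)
    (f : EuclideanSpace ℝ (Fin d) → ℝ) (hf : ContinuousOn f (frontier V)) :
    (∀ r ∈ Ioo (0 : ℝ) 1, ∀ v ∈ V,
      (∀ᵐ ω ∂P,
        Tendsto (fun n => WalkOnSpheres.walk V ϑ r v n ω) atTop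
          (𝓝 (WalkOnSpheres.walkLimit V ϑ r v ω)) ∧
        WalkOnSpheres.walkLimit V ϑ r v ω ∈ frontier V) ∧
      Integrable (fun ω => f (WalkOnSpheres.walkLimit V ϑ r v ω)) P) ∧
    (∀ r ∈ Ioo (0 : ℝ) 1, ∀ s ∈ Ioo (0 : ℝ) 1,
      WalkOnSpheres.dirichletFun P V ϑ f r = WalkOnSpheres.dirichletFun P V ϑ f s) ∧
    (∀ r ∈ Ioo (0 : ℝ) 1, ∀ s ∈ Ioo (0 : ℝ) 1, ∀ v ∈ V,
      IdentDistrib (WalkOnSpheres.walkLimit V ϑ r v) (WalkOnSpheres.walkLimit V ϑ s v) P P) := by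
  have : NeZero d := ⟨by omega⟩
  have h : WalkOnSpheres.IsUniformDirections P ϑ := ⟨hmeas, hindep, hlaw⟩
  -- only the values of `f` on the boundary matter, so `f` may be replaced by a measurable function
  set F : EuclideanSpace ℝ (Fin d) → ℝ := (frontier V).indicator f with hF
  have hFm : Measurable F := by
    classical
    have : Measurable ((frontier V).piecewise f 0) :=
      hf.measurable_piecewise continuousOn_const isClosed_frontier.measurableSet
    rwa [piecewise_eq_indicator] at this
  have hFeq : ∀ {r : ℝ}, r ∈ Ioo (0 : ℝ) 1 → ∀ {v : EuclideanSpace ℝ (Fin d)}, v ∈ V →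
      (fun ω => f (WalkOnSpheres.walkLimit V ϑ r v ω)) =ᵐ[P]
        fun ω => F (WalkOnSpheres.walkLimit V ϑ r v ω) := by
    intro r hr v hv
    filter_upwards [h.ae_tendsto_walkLimit hopen hbdd hr hv] with ω hω
    exact (indicator_of_mem hω.2 f).symm
  refine ⟨fun r hr v hv => ⟨h.ae_tendsto_walkLimit hopen hbdd hr hv, ?_⟩, fun r hr s hs => ?_,
    fun r hr s hs v hv => h.identDistrib_walkLimit hopen hbdd hr hs hv⟩
  · obtain ⟨C, hC⟩ := (hbdd.isCompact_closure.of_isClosed_subset isClosed_frontier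
      frontier_subset_closure).exists_bound_of_continuousOn hf
    refine Integrable.of_bound (((hFm.comp_aemeasurable
      (h.aemeasurable_walkLimit hopen hbdd hr hv)).congr (hFeq hr hv).symm).aestronglyMeasurable)
      C ?_
    filter_upwards [h.ae_tendsto_walkLimit hopen hbdd hr hv] with ω hω using hC _ hω.2
  · ext ⟨v, hv⟩
    unfold WalkOnSpheres.dirichletFun
    split_ifs with hvf
    · rfl
    · have hvV : v ∈ V := by
        by_contra hvV
        exact hvf (by rw [hopen.frontier_eq]; exact ⟨hv, hvV⟩)
      rw [integral_congr_ae (hFeq hr hvV), integral_congr_ae (hFeq hs hvV)]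
      exact ((h.identDistrib_walkLimit hopen hbdd hr hs hvV).comp hFm).integral_eq
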